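/- (i) Let $0\le a<1$, $d\in\mathbb{R}$ and $\sigma>0$. Consider a single trajectory $\tilde x_1=0$, $\tilde x_{j+1}=a\,\tilde x_j+d+\tilde z_j$ $(j\ge 1)$, where $\tilde z_1,\tilde z_2,\dots$ are independent $\mathcal N(0,\sigma^2)$ random variables. From $\tilde x_1,\dots,\tilde x_{n+1}$ let $\overline X\in\mathbb{R}^{n\times 2}$ have rows $(\tilde x_j,1)$, let $Y\in\mathbb{R}^n$ have entries $\tilde x_{j+1}$ $(1\le j\le n)$, and let $\widehat A=(\overline X^\top\overline X)^{-1}\overline X^\top Y$ be the ordinary least squares estimator of $A=(a,d)^\top$. Put $$\psi=\psi(a,d,\sigma)=\sqrt{\min\left\{\frac{\sigma^2(1-a)^2}{16d^2(1-a^2)+(1-a)^2\sigma^2},\ \frac{\sigma^2}{4(1-a^2)}\right\}}.$$ There is a constant $C>0$, depending only on $(a,d,\sigma)$, such that for every $\delta\in(0,1)$ there is $n_0$, depending only on $\delta$ and $(a,d,\sigma)$, such that for all $n\ge n_0$ the matrix $\overline X^\top\overline X$ is almost surely invertible and $$\mathbb{P}\left(\|\widehat A-A\|_2\ \ge\ C\sqrt{1+\log(1/\delta)}\,\sqrt{\frac{1}{\psi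 n}}\right)\le\delta .$$ (ii) Consider an arm with satiation retention factor $\gamma\in[0,1)$, exposure influence factor $\lambda>0$, base reward $b\in\mathbb{R}$ and satiation noise variance $\sigma_z^2>0$, which is pulled exactly at the times $t_0,t_0+m,t_0+2m,\dots$, where $m\ge1$. Its satiation level is $s_t=0$ for $t\le t_0$ and $s_t=\gamma(s_{t-1}+u_{t-1})+z_{t-1}$ for $t>t_0$, where $u_t\in\{0,1\}$ indicates whether the arm is pulled at time $t$ and the $z_t$ are independent $\mathcal N(0,\sigma_z^2)$ random variables; a pull at time $t$ yields the reward $b-\lambda s_t$. Let $\tilde x_j$ be the difference between the first reward and the $j$-th reward. Then the conclusion of (i) holds for the least squares estimator computed from $\tilde x_1,\dots,\tilde x_{n+1}$, with $a=\gamma^m$, $d=\lambda\gamma^m$ and $\sigma^2=\lambda^2\sigma_z^2(1-\gamma^{2m})/(1-\gamma^2)$, where $C$ depends only on $(\gamma,\lambda,\sigma_z,m)$ and $n_0$ only on $\delta$ and $(\gamma,\lambda,\sigma_z,m)$. In particular, this holds for $m=1$, where $a=\gamma$, $d=\lambda\gamma$ and $\sigma=\lambda\sigma_z$. -/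

import Mathlib

open MeasureTheory ProbabilityTheory

open scoped NNReal ENNReal Matrix

noncomputable section

/-- The trajectory `x 0 = 0`, `x (j + 1) = a * x j + d + z j` of the scalar affine system with
noise sequence `z`. (Time is counted from `0`, so `x j` is the `(j + 1)`-st observation.) -/
def affineTrajectory (a d : ℝ) (z : ℕ → ℝ) : ℕ → ℝ
  | 0 => 0
  | j + 1 => a * affineTrajectory a d z j + d + z j

/-- The `n × 2` matrix of covariates, with rows `(x j, 1)`, `0 ≤ j < n`. -/
def designMatrix (n : ℕ) (x : ℕ → ℝ) : Matrix (Fin n) (Fin 2) ℝ :=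
  Matrix.of fun j => ![x j, 1]

/-- The vector of responses, with entries `x (j + 1)`, `0 ≤ j < n`. -/
def responseVector (n : ℕ) (x : ℕ → ℝ) : Fin n → ℝ :=
  fun j => x (j + 1)

/-- The Gram matrix `Xᵀ X` of the covariates. -/
def gramMatrix (n : ℕ) (x : ℕ → ℝ) : Matrix (Fin 2) (Fin 2) ℝ :=
  (designMatrix n x)ᵀ * designMatrix n x

/-- The ordinary least squares estimator `(Xᵀ X)⁻¹ Xᵀ Y` computed from the `n + 1` observations
`x 0, …, x n`, as a vector of the Euclidean plane. -/
def olsEstimator (n : ℕ) (x : ℕ → ℝ) : EuclideanSpace ℝ (Fin 2) :=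
  WithLp.toLp 2 ((gramMatrix n x)⁻¹ *ᵥ ((designMatrix n x)ᵀ *ᵥ responseVector n x))

/-- The constant `ψ` of the affine system with parameters `a`, `d` and noise standard
deviation `σ`. -/
def psi (a d σ : ℝ) : ℝ :=
  √(min (σ ^ 2 * (1 - a) ^ 2 / (16 * d ^ 2 * (1 - a ^ 2) + (1 - a) ^ 2 * σ ^ 2))
    (σ ^ 2 / (4 * (1 - a ^ 2))))

/-- `z 0, z 1, …` are independent random variables with law `N(0, σ ^ 2)`. -/
def IsGaussianNoise {Ω : Type*} [MeasurableSpace Ω] (μ : Measure Ω) (σ : ℝ≥0)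
    (z : ℕ → Ω → ℝ) : Prop :=
  iIndepFun z μ ∧ ∀ t, HasLaw (z t) (gaussianReal 0 (σ ^ 2)) μ

open Classical in
/-- The satiation level of an arm with retention factor `γ` that is pulled exactly at the times
in `pulls`: it is `0` up to and including the time of the first pull, and from then on
`s (t + 1) = γ * (s t + u t) + z t`, where `u t` is `1` if the arm is pulled at time `t` and
`0` otherwise. -/
def satiation (γ : ℝ) (pulls : Set ℕ) (z : ℕ → ℝ) : ℕ → ℝ
  | 0 => 0
  | t + 1 =>
    if ∃ i ≤ t, i ∈ pulls then
      γ * (satiation γ pulls z t + if t ∈ pulls then 1 else 0) + z t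
    else 0

/-- The reward `b - lam * s t` received from a pull at time `t`. -/
def reward (b lam γ : ℝ) (pulls : Set ℕ) (z : ℕ → ℝ) (t : ℕ) : ℝ :=
  b - lam * satiation γ pulls z t

/-- Pulls at the times `t₀, t₀ + m, t₀ + 2 * m, …`. -/
def periodicPulls (t₀ m : ℕ) : Set ℕ := {t | ∃ j : ℕ, t = t₀ + j * m}

/-- The observed satiation influences of an arm pulled at the times `t₀, t₀ + m, …`: the `j`-th
one (counted from `0`) is the first reward minus the reward at time `t₀ + j * m`. -/
def observedInfluence (b lam γ : ℝ) (t₀ m : ℕ) (z : ℕ → ℝ) (j : ℕ) : ℝ :=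
  reward b lam γ (periodicPulls t₀ m) z t₀ - reward b lam γ (periodicPulls t₀ m) z (t₀ + j * m)

/-- The standard deviation of the noise accumulated in the satiation influence between two
consecutive pulls at distance `m`. -/
def influenceNoiseSd (lam γ σz : ℝ) (m : ℕ) : ℝ :=
  √(lam ^ 2 * σz ^ 2 * (1 - γ ^ (2 * m)) / (1 - γ ^ 2))

end

/-!
The estimation error of least squares is `(Xᵀ X)⁻¹ Xᵀ z`, so by Cramer's rule
(`olsEstimator_sub_eq`) it is controlled by `∑ z j`, `∑ x j * z j`, `∑ x j ^ 2` and the determinant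
of the Gram matrix, which is `n` times the dispersion of `x` around its mean.

The constant may depend on the parameters in any way and `n₀` may depend on `δ`, so conditioning of
the design may fail with a probability that is merely `O(1 / n)`. It follows pathwise from two weak
laws of large numbers, for `∑ z j ^ 2` and for `∑ z j`, which Chebyshev's inequality gives
(`IsGaussianNoise.measure_abs_sum_sub_ge_le`). Convexity of the square bounds `∑ x j ^ 2` by a
multiple of `n` (`sum_sq_affineTrajectory_le`). As `z j` is, up to a constant independent of `j`, the
combination `(x (j + 1) - c) - a * (x j - c)` for any level `c`, the dispersion of `x` is at least a
quarter of the dispersion of `z` (`sum_sq_noise_sub_le`), so the determinant is of order `n ^ 2`.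

The two linear terms need the correct dependence on `δ` and get it from the exponential martingale
`exp (∑ (w j * z j - σ ^ 2 * w j ^ 2 / 2))` of Gaussian noise with predictable weights: once
`∑ w j ^ 2 ≤ V`, the sum `∑ w j * z j` has a Gaussian tail of variance `σ ^ 2 * V`
(`IsGaussianNoise.measure_le_sum_le`). It is used with `w j = 1` and with `w j = x j`, at level
`2 * σ * √(V * L)`, where `L = 1 + log (1 / δ)`.

For the arm, unrolling the satiation recursion between consecutive pulls shows that the observed
influence is a trajectory of an affine system (`observedInfluence_eq_affineTrajectory`). Its noise
consists of weighted sums of the satiation noise over disjoint windows of length `m`, so it is again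
Gaussian noise (`IsGaussianNoise.sum_blocks`), and the bound for a single trajectory applies.
-/

/-! ### Pathwise estimates for the trajectory -/

/-- Convexity of the square gives `x (j + 1) ^ 2 ≤ a * x j ^ 2 + (d + z j) ^ 2 / (1 - a)`, which
telescopes to a bound on the energy of the trajectory by that of the noise. -/
theorem sum_sq_affineTrajectory_le {a d : ℝ} (ha0 : 0 ≤ a) (ha1 : a < 1) (z : ℕ → ℝ) (k : ℕ) :
    ∑ j ∈ Finset.range (k + 1), affineTrajectory a d z j ^ 2 ≤
      2 * (k * d ^ 2 + ∑ j ∈ Finset.range k, z j ^ 2) / (1 - a) ^ 2 := by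
  have h1 : 0 < 1 - a := by linarith
  have key : (1 - a) * ((1 - a) * ∑ j ∈ Finset.range (k + 1), affineTrajectory a d z j ^ 2 +
      a * affineTrajectory a d z k ^ 2) ≤ 2 * (k * d ^ 2 + ∑ j ∈ Finset.range k, z j ^ 2) := by
    induction k with
    | zero => simp [affineTrajectory]
    | succ k ih =>
      rw [Finset.sum_range_succ, Finset.sum_range_succ (fun j => z j ^ 2)]
      have hx : affineTrajectory a d z (k + 1) = a * affineTrajectory a d z k + d + z k := rfl
      set x := affineTrajectory a d z k
      set y := affineTrajectory a d z (k + 1)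
      have : (1 - a) * (y ^ 2 - a * x ^ 2) ≤ 2 * (d ^ 2 + z k ^ 2) := by
        rw [hx]
        nlinarith [mul_nonneg ha0 (sq_nonneg ((1 - a) * x - (d + z k))), sq_nonneg (d - z k)]
      push_cast
      nlinarith
  rw [le_div_iff₀ (by positivity)]
  nlinarith [mul_nonneg h1.le (mul_nonneg ha0 (sq_nonneg (affineTrajectory a d z k)))]

/-- The dispersion of the trajectory around any level `c` dominates the empirical variance of the
noise, since `z j + (d - (1 - a) * c) = (x (j + 1) - c) - a * (x j - c)`. -/
theorem sum_sq_noise_sub_le {a d : ℝ} (ha0 : 0 ≤ a) (ha1 : a < 1) (z : ℕ → ℝ) (c : ℝ) {k : ℕ}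
    (hk : 0 < k) :
    ∑ j ∈ Finset.range k, z j ^ 2 - (∑ j ∈ Finset.range k, z j) ^ 2 / k ≤
      4 * ∑ j ∈ Finset.range (k + 1), (affineTrajectory a d z j - c) ^ 2 := by
  set e := d - (1 - a) * c with he
  have h1 : ∑ j ∈ Finset.range k, z j ^ 2 - (∑ j ∈ Finset.range k, z j) ^ 2 / k ≤
      ∑ j ∈ Finset.range k, (z j + e) ^ 2 := by
    have hk' : (0 : ℝ) < k := by exact_mod_cast hk
    have : ∑ j ∈ Finset.range k, (z j + e) ^ 2 = ∑ j ∈ Finset.range k, z j ^ 2 +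
        2 * e * ∑ j ∈ Finset.range k, z j + k * e ^ 2 := by
      simp only [add_sq, Finset.sum_add_distrib, Finset.mul_sum, Finset.sum_const,
        Finset.card_range, nsmul_eq_mul]
      congr 2
      exact Finset.sum_congr rfl fun _ _ => by ring
    rw [this]
    set S := ∑ j ∈ Finset.range k, z j
    have h2 : 0 ≤ (S + k * e) ^ 2 / k := by positivity
    have h3 : (S + k * e) ^ 2 / k = S ^ 2 / k + 2 * e * S + k * e ^ 2 := by field_simp; ring
    linarith
  refine h1.trans ?_
  have key : ∀ k : ℕ, ∑ j ∈ Finset.range k, (z j + e) ^ 2 +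
      2 * (affineTrajectory a d z k - c) ^ 2 ≤
      4 * ∑ j ∈ Finset.range (k + 1), (affineTrajectory a d z j - c) ^ 2 := by
    intro k
    induction k with
    | zero => simp; nlinarith [sq_nonneg (affineTrajectory a d z 0 - c)]
    | succ k ih =>
      rw [Finset.sum_range_succ, Finset.sum_range_succ _ (k + 1)]
      have hx : affineTrajectory a d z (k + 1) = a * affineTrajectory a d z k + d + z k := rfl
      set x := affineTrajectory a d z k
      set y := affineTrajectory a d z (k + 1)
      have hz : z k + e = (y - c) - a * (x - c) := by rw [hx, he]; ring
      rw [hz]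
      have : a ^ 2 * (x - c) ^ 2 ≤ (x - c) ^ 2 :=
        mul_le_of_le_one_left (sq_nonneg _) (by nlinarith)
      nlinarith [sq_nonneg ((y - c) + a * (x - c))]
  linarith [key k, sq_nonneg (affineTrajectory a d z k - c)]

/-! ### The least squares estimator in coordinates -/

theorem gramMatrix_eq (n : ℕ) (x : ℕ → ℝ) :
    gramMatrix n x = !![∑ j ∈ Finset.range n, x j ^ 2, ∑ j ∈ Finset.range n, x j;
      ∑ j ∈ Finset.range n, x j, n] := by
  ext i j
  fin_cases i <;> fin_cases j <;>
    simp [gramMatrix, designMatrix, Matrix.mul_apply, Finset.sum_range, sq]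

theorem det_gramMatrix (n : ℕ) (x : ℕ → ℝ) :
    (gramMatrix n x).det =
      n * ∑ j ∈ Finset.range n, x j ^ 2 - (∑ j ∈ Finset.range n, x j) ^ 2 := by
  rw [gramMatrix_eq, Matrix.det_fin_two_of]
  ring

/-- The determinant of the Gram matrix is `n ^ 2` times the empirical variance of `x`. -/
theorem det_gramMatrix_eq_sum_sq_sub {n : ℕ} (hn : 0 < n) (x : ℕ → ℝ) :
    (gramMatrix n x).det =
      n * ∑ j ∈ Finset.range n, (x j - (∑ i ∈ Finset.range n, x i) / n) ^ 2 := by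
  have hn' : (n : ℝ) ≠ 0 := by positivity
  rw [det_gramMatrix]
  simp only [sub_sq, Finset.sum_add_distrib, Finset.sum_sub_distrib, ← Finset.sum_mul,
    ← Finset.mul_sum, Finset.sum_const, Finset.card_range, nsmul_eq_mul]
  field_simp
  ring

/-- The normal equations of the affine system, solved by Cramer's rule: the estimation error is
linear in `∑ z j` and `∑ x j * z j`. -/
theorem olsEstimator_sub_eq {a d : ℝ} (z : ℕ → ℝ) {n : ℕ}
    (hdet : (gramMatrix n (affineTrajectory a d z)).det ≠ 0) :
    olsEstimator n (affineTrajectory a d z) - !₂[a, d] =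
      !₂[(n * ∑ j ∈ Finset.range n, affineTrajectory a d z j * z j -
          (∑ j ∈ Finset.range n, affineTrajectory a d z j) * ∑ j ∈ Finset.range n, z j) /
            (gramMatrix n (affineTrajectory a d z)).det,
        ((∑ j ∈ Finset.range n, affineTrajectory a d z j ^ 2) * ∑ j ∈ Finset.range n, z j -
          (∑ j ∈ Finset.range n, affineTrajectory a d z j) *
            ∑ j ∈ Finset.range n, affineTrajectory a d z j * z j) /
            (gramMatrix n (affineTrajectory a d z)).det] := by
  set x := affineTrajectory a d z with hx
  have hxs : ∀ j, x (j + 1) = a * x j + d + z j := fun j => rfl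
  have hD := det_gramMatrix n x
  set D := (gramMatrix n x).det with hDdef
  have hw : (designMatrix n x)ᵀ *ᵥ responseVector n x =
      ![a * ∑ j ∈ Finset.range n, x j ^ 2 + d * ∑ j ∈ Finset.range n, x j +
          ∑ j ∈ Finset.range n, x j * z j,
        a * ∑ j ∈ Finset.range n, x j + d * n + ∑ j ∈ Finset.range n, z j] := by
    have e0 : a * ∑ j ∈ Finset.range n, x j ^ 2 + d * ∑ j ∈ Finset.range n, x j +
        ∑ j ∈ Finset.range n, x j * z j = ∑ j ∈ Finset.range n, x j * x (j + 1) := by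
      simp only [Finset.mul_sum, ← Finset.sum_add_distrib, hxs]
      exact Finset.sum_congr rfl fun _ _ => by ring
    have e1 : a * ∑ j ∈ Finset.range n, x j + d * n + ∑ j ∈ Finset.range n, z j =
        ∑ j ∈ Finset.range n, x (j + 1) := by
      simp [hxs, Finset.sum_add_distrib, Finset.mul_sum, mul_comm]
    rw [e0, e1]
    ext i
    fin_cases i <;>
      simp [designMatrix, responseVector, Matrix.mulVec, dotProduct, Finset.sum_range]
  have hinv : (gramMatrix n x)⁻¹ = D⁻¹ • !![(n : ℝ), -∑ j ∈ Finset.range n, x j;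
      -∑ j ∈ Finset.range n, x j, ∑ j ∈ Finset.range n, x j ^ 2] := by
    rw [Matrix.inv_def, ← hDdef, Ring.inverse_eq_inv', gramMatrix_eq, Matrix.adjugate_fin_two_of]
  have hD0 : D ≠ 0 := hdet
  ext i
  fin_cases i
  · simp [olsEstimator, hw, hinv]
    field_simp
    rw [hD]
    ring
  · simp [olsEstimator, hw, hinv]
    field_simp
    rw [hD]
    ring

/-! ### Concentration for Gaussian noise -/

theorem measurable_affineTrajectory (a d : ℝ) (j : ℕ) :
    Measurable fun z : ℕ → ℝ => affineTrajectory a d z j := by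
  induction j with
  | zero => simp only [affineTrajectory]; fun_prop
  | succ j ih => simp only [affineTrajectory]; fun_prop

theorem affineTrajectory_congr {a d : ℝ} {z z' : ℕ → ℝ} {j : ℕ} (h : ∀ i < j, z i = z' i) :
    affineTrajectory a d z j = affineTrajectory a d z' j := by
  induction j with
  | zero => rfl
  | succ j ih =>
    simp only [affineTrajectory]
    rw [ih fun i hi => h i (by omega), h j (by omega)]

section Noise

variable {Ω : Type*} [MeasurableSpace Ω] {μ : Measure Ω} {σ : ℝ≥0} {z : ℕ → Ω → ℝ}

theorem IsGaussianNoise.aemeasurable (hz : IsGaussianNoise μ σ z) (t : ℕ) :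
    AEMeasurable (z t) μ :=
  (hz.2 t).aemeasurable

/-- A functional of the noise before time `n` is independent of the noise at time `n`. -/
theorem IsGaussianNoise.indepFun_past (hz : IsGaussianNoise μ σ z) {β : Type*} [MeasurableSpace β]
    {g : (ℕ → ℝ) → β} (hg : Measurable g) (n : ℕ)
    (hdep : ∀ w w' : ℕ → ℝ, (∀ i < n, w i = w' i) → g w = g w') :
    IndepFun (fun ω => g fun t => z t ω) (z n) μ := by
  -- The functional is evaluated at the past, continued by zero.
  let ext0 : (Finset.range n → ℝ) → ℕ → ℝ :=
    fun w i => if h : i ∈ Finset.range n then w ⟨i, h⟩ else 0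
  have hext : Measurable ext0 := by
    refine measurable_pi_lambda _ fun i => ?_
    by_cases h : i ∈ Finset.range n
    · simp only [ext0, h, dite_true]; fun_prop
    · simp only [ext0, h, dite_false]; fun_prop
  have hind := hz.1.indepFun_finset₀ (Finset.range n) {n} (by simp) hz.aemeasurable
  have := hind.comp (hg.comp hext)
    (measurable_pi_apply (⟨n, by simp⟩ : ({n} : Finset ℕ)))
  convert this using 1
  · ext ω
    refine hdep _ _ fun i hi => ?_
    simp [ext0, hi]
  · rfl

/-- The weights `w j` are predictable: the weight at time `j` depends on the noise before `j`. -/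
structure IsPredictable (w : ℕ → (ℕ → ℝ) → ℝ) : Prop where
  measurable (j : ℕ) : Measurable (w j)
  congr (j : ℕ) {y y' : ℕ → ℝ} (h : ∀ i < j, y i = y' i) : w j y = w j y'

theorem lintegral_exp_gaussianReal (σ : ℝ≥0) (m u : ℝ) :
    ∫⁻ t, ENNReal.ofReal (Real.exp (m + (u * t - σ ^ 2 * u ^ 2 / 2))) ∂gaussianReal 0 (σ ^ 2) =
      ENNReal.ofReal (Real.exp m) := by
  have hint : Integrable (fun t => Real.exp (u * t)) (gaussianReal 0 (σ ^ 2)) :=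
    integrable_exp_mul_gaussianReal u
  have hmgf : ∫ t, Real.exp (u * t) ∂gaussianReal 0 (σ ^ 2) = Real.exp (σ ^ 2 * u ^ 2 / 2) := by
    have := congrFun (mgf_fun_id_gaussianReal (μ := 0) (v := σ ^ 2)) u
    simpa [mgf] using this
  have e : ∀ t, Real.exp (m + (u * t - σ ^ 2 * u ^ 2 / 2)) =
      Real.exp (m - σ ^ 2 * u ^ 2 / 2) * Real.exp (u * t) := fun t => by
    rw [← Real.exp_add]; ring_nf
  simp only [e]
  rw [← ofReal_integral_eq_lintegral_ofReal (hint.const_mul _)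
    (Filter.Eventually.of_forall fun t => by positivity), integral_const_mul, hmgf,
    ← Real.exp_add]
  ring_nf

/-- The exponential martingale of a sum of Gaussian noise with predictable weights. -/
theorem IsGaussianNoise.lintegral_exp_sum (hz : IsGaussianNoise μ σ z) [IsProbabilityMeasure μ]
    {w : ℕ → (ℕ → ℝ) → ℝ} (hw : IsPredictable w) (n : ℕ) :
    ∫⁻ ω, ENNReal.ofReal (Real.exp (∑ j ∈ Finset.range n,
      (w j (fun t => z t ω) * z j ω - σ ^ 2 * w j (fun t => z t ω) ^ 2 / 2))) ∂μ = 1 := by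
  have hZ : AEMeasurable (fun ω t => z t ω) μ := aemeasurable_pi_iff.2 hz.aemeasurable
  induction n with
  | zero => simp
  | succ n ih =>
    let g : (ℕ → ℝ) → ℝ × ℝ := fun y =>
      (∑ j ∈ Finset.range n, (w j y * y j - σ ^ 2 * w j y ^ 2 / 2), w n y)
    have hwm := hw.measurable
    have hg : Measurable g := by
      refine Measurable.prodMk ?_ (hwm n)
      exact Finset.measurable_sum _ fun j _ => by fun_prop
    have hind := hz.indepFun_past hg n fun y y' h => by
      simp only [g, Prod.mk.injEq]
      refine ⟨Finset.sum_congr rfl fun j hj => ?_, hw.congr n h⟩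
      have hj' := Finset.mem_range.1 hj
      rw [hw.congr j fun i hi => h i (hi.trans hj'), h j hj']
    have hgm : AEMeasurable (fun ω => g fun t => z t ω) μ := hg.comp_aemeasurable hZ
    have hlaw := (indepFun_iff_map_prod_eq_prod_map_map hgm (hz.aemeasurable n)).1 hind
    rw [(hz.2 n).map_eq] at hlaw
    let f : (ℝ × ℝ) × ℝ → ℝ≥0∞ := fun p =>
      ENNReal.ofReal (Real.exp (p.1.1 + (p.1.2 * p.2 - σ ^ 2 * p.1.2 ^ 2 / 2)))
    have hf : Measurable f := by fun_prop
    calc _ = ∫⁻ ω, f (g (fun t => z t ω), z n ω) ∂μ := by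
          simp only [f, g, Finset.sum_range_succ]
      _ = ∫⁻ p, f p ∂((μ.map fun ω => g fun t => z t ω).prod (gaussianReal 0 (σ ^ 2))) := by
          rw [← hlaw, lintegral_map' hf.aemeasurable (hgm.prodMk (hz.aemeasurable n))]
      _ = ∫⁻ q, ENNReal.ofReal (Real.exp q.1) ∂(μ.map fun ω => g fun t => z t ω) := by
          rw [lintegral_prod _ hf.aemeasurable]
          simp only [f, lintegral_exp_gaussianReal]
      _ = 1 := by
          rw [lintegral_map' (by fun_prop) hgm, ← ih]

/-- Self-normalized Gaussian tail: a sum of Gaussian noise with predictable weights is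
sub-Gaussian on the event that the squared weights add up to at most `V`. -/
theorem IsGaussianNoise.measure_le_sum_le (hz : IsGaussianNoise μ σ z) [IsProbabilityMeasure μ]
    (hσ : 0 < σ) {w : ℕ → (ℕ → ℝ) → ℝ} (hw : IsPredictable w) (n : ℕ) {u V : ℝ} (hu : 0 ≤ u)
    (hV : 0 < V) :
    μ {ω | u ≤ ∑ j ∈ Finset.range n, w j (fun t => z t ω) * z j ω ∧
        ∑ j ∈ Finset.range n, w j (fun t => z t ω) ^ 2 ≤ V} ≤
      ENNReal.ofReal (Real.exp (-(u ^ 2 / (2 * σ ^ 2 * V)))) := by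
  have hσ' : (0 : ℝ) < σ := hσ
  have hZ : AEMeasurable (fun ω t => z t ω) μ := aemeasurable_pi_iff.2 hz.aemeasurable
  -- The exponent `θ * u - σ ^ 2 * θ ^ 2 * V / 2` is largest at this `θ`.
  set θ : ℝ := u / (σ ^ 2 * V) with hθ
  have hθ0 : 0 ≤ θ := by positivity
  have hw' : IsPredictable fun j y => θ * w j y :=
    ⟨fun j => (hw.measurable j).const_mul θ, fun j _ _ h => by rw [hw.congr j h]⟩
  have hE := hz.lintegral_exp_sum hw' n
  set s : ℝ := u ^ 2 / (2 * σ ^ 2 * V) with hs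
  have hwm := hw.measurable
  have hmeas : AEMeasurable (fun ω => ENNReal.ofReal (Real.exp (∑ j ∈ Finset.range n,
      (θ * w j (fun t => z t ω) * z j ω - σ ^ 2 * (θ * w j (fun t => z t ω)) ^ 2 / 2)))) μ := by
    have : Measurable fun y : ℕ → ℝ => ENNReal.ofReal (Real.exp (∑ j ∈ Finset.range n,
      (θ * w j y * y j - σ ^ 2 * (θ * w j y) ^ 2 / 2))) := by
      refine (Real.measurable_exp.comp ?_).ennreal_ofReal
      exact Finset.measurable_sum _ fun j _ => by fun_prop
    exact this.comp_aemeasurable hZ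
  have hmk := mul_meas_ge_le_lintegral₀ hmeas (ENNReal.ofReal (Real.exp s))
  rw [hE] at hmk
  have hsub : {ω | u ≤ ∑ j ∈ Finset.range n, w j (fun t => z t ω) * z j ω ∧
        ∑ j ∈ Finset.range n, w j (fun t => z t ω) ^ 2 ≤ V} ⊆
      {ω | ENNReal.ofReal (Real.exp s) ≤ ENNReal.ofReal (Real.exp (∑ j ∈ Finset.range n,
        (θ * w j (fun t => z t ω) * z j ω - σ ^ 2 * (θ * w j (fun t => z t ω)) ^ 2 / 2)))} := by
    rintro ω ⟨h1, h2⟩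
    refine ENNReal.ofReal_le_ofReal (Real.exp_le_exp.2 ?_)
    have e : ∑ j ∈ Finset.range n,
        (θ * w j (fun t => z t ω) * z j ω - σ ^ 2 * (θ * w j (fun t => z t ω)) ^ 2 / 2) =
        θ * ∑ j ∈ Finset.range n, w j (fun t => z t ω) * z j ω -
          σ ^ 2 * θ ^ 2 / 2 * ∑ j ∈ Finset.range n, w j (fun t => z t ω) ^ 2 := by
      rw [Finset.mul_sum, Finset.mul_sum, ← Finset.sum_sub_distrib]
      exact Finset.sum_congr rfl fun _ _ => by ring
    have e2 : s = θ * u - σ ^ 2 * θ ^ 2 / 2 * V := by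
      rw [hs, hθ]; field_simp; ring
    rw [e, e2]
    have h3 := mul_le_mul_of_nonneg_left h1 hθ0
    have h4 := mul_le_mul_of_nonneg_left h2 (by positivity : 0 ≤ (σ : ℝ) ^ 2 * θ ^ 2 / 2)
    linarith
  refine (measure_mono hsub).trans ?_
  rw [Real.exp_neg, ENNReal.ofReal_inv_of_pos (Real.exp_pos _), ENNReal.le_inv_iff_mul_le, mul_comm]
  exact hmk

/-- The weak law of large numbers for functions of the noise, with Chebyshev's rate. -/
theorem IsGaussianNoise.measure_abs_sum_sub_ge_le (hz : IsGaussianNoise μ σ z)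
    [IsProbabilityMeasure μ] {f : ℝ → ℝ} (hf : Measurable f)
    (hf2 : MemLp f 2 (gaussianReal 0 (σ ^ 2))) {ε : ℝ} (hε : 0 < ε) {k : ℕ} (hk : 0 < k) :
    μ {ω | ε * k ≤ |∑ j ∈ Finset.range k, f (z j ω) - k * ∫ t, f t ∂gaussianReal 0 (σ ^ 2)|} ≤
      ENNReal.ofReal (Var[f; gaussianReal 0 (σ ^ 2)] / (ε ^ 2 * k)) := by
  have hk' : (0 : ℝ) < k := by exact_mod_cast hk
  have hmem : ∀ j, MemLp (fun ω => f (z j ω)) 2 μ := fun j => by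
    have : MemLp f 2 (μ.map (z j)) := by rwa [(hz.2 j).map_eq]
    exact this.comp_of_map (hz.aemeasurable j)
  have hvar : ∀ j, Var[fun ω => f (z j ω); μ] = Var[f; gaussianReal 0 (σ ^ 2)] := fun j => by
    rw [← (hz.2 j).map_eq, variance_map hf.aemeasurable (hz.aemeasurable j)]
    rfl
  have hint : ∀ j, ∫ ω, f (z j ω) ∂μ = ∫ t, f t ∂gaussianReal 0 (σ ^ 2) := fun j =>
    (hz.2 j).integral_comp hf.aestronglyMeasurable
  have hsum : MemLp (∑ j ∈ Finset.range k, fun ω => f (z j ω)) 2 μ :=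
    memLp_finsetSum' _ fun j _ => hmem j
  have hV : Var[∑ j ∈ Finset.range k, fun ω => f (z j ω); μ] =
      k * Var[f; gaussianReal 0 (σ ^ 2)] := by
    rw [IndepFun.variance_sum (fun j _ => hmem j)
      fun i _ j _ hij => (hz.1.indepFun hij).comp hf hf]
    simp [hvar]
  have hI : ∫ ω, (∑ j ∈ Finset.range k, fun ω => f (z j ω)) ω ∂μ =
      k * ∫ t, f t ∂gaussianReal 0 (σ ^ 2) := by
    simp only [Finset.sum_apply]
    rw [integral_finsetSum _ fun j _ => (hmem j).integrable (by norm_num)]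
    simp [hint]
  have := meas_ge_le_variance_div_sq hsum (c := ε * k) (by positivity)
  rw [hV, hI] at this
  have e : k * Var[f; gaussianReal 0 (σ ^ 2)] / (ε * k) ^ 2 =
      Var[f; gaussianReal 0 (σ ^ 2)] / (ε ^ 2 * k) := by
    field_simp
  rw [e] at this
  simpa using this

end Noise

theorem integral_sq_gaussianReal (σ : ℝ≥0) :
    ∫ t, t ^ 2 ∂gaussianReal 0 (σ ^ 2) = σ ^ 2 := by
  have h := variance_fun_id_gaussianReal (μ := 0) (v := σ ^ 2)
  rw [variance_of_integral_eq_zero (by fun_prop) (by simp)] at h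
  simpa using h

theorem memLp_sq_gaussianReal (σ : ℝ≥0) :
    MemLp (fun t : ℝ => t ^ 2) 2 (gaussianReal 0 (σ ^ 2)) := by
  have h : MemLp (id : ℝ → ℝ) 4 (gaussianReal 0 (σ ^ 2)) := memLp_id_gaussianReal' 4 (by simp)
  have h2 := h.norm_rpow_div 2
  have e : (4 : ℝ≥0∞) / 2 = 2 := by
    rw [show (4 : ℝ≥0∞) = 2 * 2 by norm_num, ENNReal.mul_div_cancel_right (by simp) (by simp)]
  rw [e] at h2
  simpa using h2

/-! ### The estimation error on the good event -/

/-- A bound for the mean square of the trajectory on the event that the mean square of the noise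
is at most `5 / 4 * σ ^ 2`. -/
noncomputable def energyBound (a d σ : ℝ) : ℝ := 4 * (d ^ 2 + σ ^ 2) / (1 - a) ^ 2

theorem energyBound_pos {a d σ : ℝ} (ha1 : a < 1) (hσ : 0 < σ) : 0 < energyBound a d σ := by
  have : 0 < 1 - a := by linarith
  unfold energyBound
  positivity

theorem sum_sq_affineTrajectory_le_energyBound {a d σ : ℝ} (ha0 : 0 ≤ a) (ha1 : a < 1)
    {z : ℕ → ℝ} {k : ℕ} (hQ : ∑ j ∈ Finset.range k, z j ^ 2 ≤ 5 / 4 * σ ^ 2 * k) :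
    ∑ j ∈ Finset.range (k + 1), affineTrajectory a d z j ^ 2 ≤ energyBound a d σ * (k + 1) := by
  refine (sum_sq_affineTrajectory_le ha0 ha1 z k).trans ?_
  have : 0 < 1 - a := by linarith
  rw [energyBound, div_mul_eq_mul_div]
  refine div_le_div_of_nonneg_right ?_ (by positivity)
  have : (0 : ℝ) ≤ k := k.cast_nonneg
  nlinarith [sq_nonneg d, sq_nonneg σ, mul_nonneg this (sq_nonneg d),
    mul_nonneg this (sq_nonneg σ)]

/-- If the noise before time `k` has mean square at least `3 / 4 * σ ^ 2` and mean at most `σ / 2` in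
absolute value, its empirical variance is at least `σ ^ 2 / 2`, and the design inherits this. -/
theorem le_det_gramMatrix {a d σ : ℝ} (ha0 : 0 ≤ a) (ha1 : a < 1)
    {z : ℕ → ℝ} {k : ℕ} (hk : 0 < k) (hQ : 3 / 4 * σ ^ 2 * k ≤ ∑ j ∈ Finset.range k, z j ^ 2)
    (hS : |∑ j ∈ Finset.range k, z j| ≤ σ / 2 * k) :
    σ ^ 2 * (k + 1) ^ 2 / 16 ≤ (gramMatrix (k + 1) (affineTrajectory a d z)).det := by
  rw [det_gramMatrix_eq_sum_sq_sub (by omega)]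
  set c := (∑ i ∈ Finset.range (k + 1), affineTrajectory a d z i) / ((k + 1 : ℕ) : ℝ)
  have h := sum_sq_noise_sub_le (d := d) ha0 ha1 z c hk
  have hk1 : (1 : ℝ) ≤ k := by exact_mod_cast hk
  have hS2 : (∑ j ∈ Finset.range k, z j) ^ 2 / k ≤ σ ^ 2 / 4 * k := by
    rw [div_le_iff₀ (by linarith)]
    have := sq_le_sq' (by linarith [abs_nonneg (∑ j ∈ Finset.range k, z j)]) hS
    rw [sq_abs] at this
    linarith
  have h2 : σ ^ 2 * (k + 1) / 16 ≤
      ∑ j ∈ Finset.range (k + 1), (affineTrajectory a d z j - c) ^ 2 := by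
    nlinarith [mul_nonneg (sq_nonneg σ) (sub_nonneg.2 hk1)]
  push_cast
  nlinarith

theorem EuclideanSpace.norm_fin_two_le (a b : ℝ) : ‖!₂[a, b]‖ ≤ |a| + |b| := by
  rw [EuclideanSpace.norm_eq]
  refine Real.sqrt_le_iff.2 ⟨by positivity, ?_⟩
  simp only [Fin.sum_univ_two, Real.norm_eq_abs]
  simp
  nlinarith [sq_abs a, sq_abs b, mul_nonneg (abs_nonneg a) (abs_nonneg b)]

/-- On the event that the design is well conditioned and that `∑ z j` and `∑ x j * z j` are of
order `√(n * L)`, the estimation error is of order `√L * √(1 / n)`. -/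
theorem norm_olsEstimator_sub_le {a d σ K L : ℝ} (hσ : 0 < σ) (hK : 0 < K) (hL : 0 ≤ L)
    {z : ℕ → ℝ} {n : ℕ} (hn : 0 < n)
    (hxx : ∑ j ∈ Finset.range n, affineTrajectory a d z j ^ 2 ≤ K * n)
    (hdet : σ ^ 2 * n ^ 2 / 16 ≤ (gramMatrix n (affineTrajectory a d z)).det)
    (hS : |∑ j ∈ Finset.range n, z j| ≤ 2 * σ * √(n * L))
    (hxz : |∑ j ∈ Finset.range n, affineTrajectory a d z j * z j| ≤ 2 * σ * √(K * n * L)) :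
    ‖olsEstimator n (affineTrajectory a d z) - !₂[a, d]‖ ≤
      64 * (√K + K) / σ * (√L * √(1 / n)) := by
  have hn' : (0 : ℝ) < n := by exact_mod_cast hn
  have hD0 : 0 < (gramMatrix n (affineTrajectory a d z)).det :=
    lt_of_lt_of_le (by positivity) hdet
  rw [olsEstimator_sub_eq z hD0.ne']
  have hx : |∑ j ∈ Finset.range n, affineTrajectory a d z j| ≤ √K * n := by
    refine abs_le_of_sq_le_sq ?_ (by positivity)
    have := sq_sum_le_card_mul_sum_sq (s := Finset.range n) (f := affineTrajectory a d z)
    rw [Finset.card_range] at this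
    rw [mul_pow, Real.sq_sqrt hK.le]
    nlinarith
  have hxx0 : 0 ≤ ∑ j ∈ Finset.range n, affineTrajectory a d z j ^ 2 :=
    Finset.sum_nonneg fun _ _ => sq_nonneg _
  set D := (gramMatrix n (affineTrajectory a d z)).det
  set Sx := ∑ j ∈ Finset.range n, affineTrajectory a d z j
  set Sxx := ∑ j ∈ Finset.range n, affineTrajectory a d z j ^ 2
  set Sxz := ∑ j ∈ Finset.range n, affineTrajectory a d z j * z j
  set S := ∑ j ∈ Finset.range n, z j
  rw [mul_assoc K, Real.sqrt_mul hK.le] at hxz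
  set r := √(n * L) with hr
  have hr0 : 0 ≤ r := Real.sqrt_nonneg _
  have hrn : r / n = √L * √(1 / n) := by
    rw [hr, mul_comm, Real.sqrt_mul hL, mul_div_assoc, Real.sqrt_div_self',
      Real.sqrt_div zero_le_one, Real.sqrt_one]
  have hk0 : 0 ≤ √K := Real.sqrt_nonneg _
  have hkk : √K * √K = K := Real.mul_self_sqrt hK.le
  -- Both numerators are at most `4 * σ * n * r` times a constant, and `D ≥ σ ^ 2 * n ^ 2 / 16`.
  have hdiv : ∀ {N c : ℝ}, 0 ≤ c → |N| ≤ 4 * σ * c * n * r → |N / D| ≤ 64 * c / σ * (r / n) := by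
    intro N c hc hN
    rw [abs_div, abs_of_pos hD0, div_le_iff₀ hD0]
    refine hN.trans ?_
    calc 4 * σ * c * n * r = 64 * c / σ * (r / n) * (σ ^ 2 * n ^ 2 / 16) := by field_simp; ring
      _ ≤ _ := by gcongr
  have h0 : |n * Sxz - Sx * S| ≤ 4 * σ * √K * n * r := by
    refine (abs_sub _ _).trans ?_
    rw [abs_mul, abs_mul, Nat.abs_cast]
    calc n * |Sxz| + |Sx| * |S| ≤ n * (2 * σ * (√K * r)) + √K * n * (2 * σ * r) := by gcongr
      _ = _ := by ring
  have h1 : |Sxx * S - Sx * Sxz| ≤ 4 * σ * K * n * r := by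
    refine (abs_sub _ _).trans ?_
    rw [abs_mul, abs_mul, abs_of_nonneg hxx0]
    calc Sxx * |S| + |Sx| * |Sxz| ≤ K * n * (2 * σ * r) + √K * n * (2 * σ * (√K * r)) := by gcongr
      _ = K * n * (2 * σ * r) + (√K * √K) * n * (2 * σ * r) := by ring
      _ = _ := by rw [hkk]; ring
  refine (EuclideanSpace.norm_fin_two_le _ _).trans
    ((add_le_add (hdiv hk0 h0) (hdiv hK.le h1)).trans ?_)
  rw [← hrn]
  apply le_of_eq
  ring

theorem psi_pos {a d σ : ℝ} (ha0 : 0 ≤ a) (ha1 : a < 1) (hσ : 0 < σ) : 0 < psi a d σ := by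
  have h1 : 0 < 1 - a := by linarith
  have h2 : 0 < 1 - a ^ 2 := by nlinarith
  exact Real.sqrt_pos.2 (lt_min (by positivity) (by positivity))

/-! ### The high-probability bound for the affine system -/

section Noise

variable {Ω : Type*} [MeasurableSpace Ω] {μ : Measure Ω} {σ : ℝ≥0} {z : ℕ → Ω → ℝ}

/-- The Gram matrix is singular only if the trajectory is constant, which forces `z 0 = -d`. -/
theorem IsGaussianNoise.ae_isUnit_det_gramMatrix (hz : IsGaussianNoise μ σ z) (hσ : 0 < σ)
    (a d : ℝ) {n : ℕ} (hn : 2 ≤ n) :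
    ∀ᵐ ω ∂μ, IsUnit (gramMatrix n (affineTrajectory a d fun t => z t ω)).det := by
  have hne : ∀ᵐ t ∂μ.map (z 0), t ≠ -d := by
    rw [(hz.2 0).map_eq]
    have := nullSingletonClass_gaussianReal (μ := 0) (v := σ ^ 2) (by positivity)
    exact Measure.ae_ne _ _
  filter_upwards [ae_of_ae_map (hz.aemeasurable 0) hne] with ω hω
  rw [isUnit_iff_ne_zero]
  intro h0
  rw [det_gramMatrix_eq_sum_sq_sub (by omega)] at h0
  have hn' : (n : ℝ) ≠ 0 := by positivity
  have h1 := (Finset.sum_eq_zero_iff_of_nonneg fun _ _ => sq_nonneg _).1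
    ((mul_eq_zero.1 h0).resolve_left hn')
  have e0 := pow_eq_zero_iff (two_ne_zero) |>.1 (h1 0 (Finset.mem_range.2 (by omega)))
  have e1 := pow_eq_zero_iff (two_ne_zero) |>.1 (h1 1 (Finset.mem_range.2 (by omega)))
  have e : affineTrajectory a d (fun t => z t ω) 1 = affineTrajectory a d (fun t => z t ω) 0 := by
    linarith
  simp [affineTrajectory] at e
  exact hω (by linarith)

/-- Two-sided form of `IsGaussianNoise.measure_le_sum_le` at the level `2 * σ * √(V * L)` with
`L = 1 + log (1 / δ)`: each side has probability at most `exp (-2 * L) ≤ δ / 6`. -/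
theorem IsGaussianNoise.measure_lt_abs_sum_le (hz : IsGaussianNoise μ σ z)
    [IsProbabilityMeasure μ] (hσ : 0 < σ) {w : ℕ → (ℕ → ℝ) → ℝ} (hw : IsPredictable w) (n : ℕ)
    {V δ : ℝ} (hV : 0 < V) (hδ0 : 0 < δ) (hδ1 : δ < 1) :
    μ {ω | 2 * σ * √(V * (1 + Real.log (1 / δ))) <
          |∑ j ∈ Finset.range n, w j (fun t => z t ω) * z j ω| ∧
        ∑ j ∈ Finset.range n, w j (fun t => z t ω) ^ 2 ≤ V} ≤ ENNReal.ofReal (δ / 3) := by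
  have hσ' : (0 : ℝ) < σ := hσ
  have hlog : 0 < Real.log (1 / δ) := Real.log_pos (by rw [lt_div_iff₀ hδ0]; linarith)
  set L := 1 + Real.log (1 / δ) with hL
  set u := 2 * σ * √(V * L) with hu
  have hexp : Real.exp (-(u ^ 2 / (2 * σ ^ 2 * V))) ≤ δ / 6 := by
    have e : -(u ^ 2 / (2 * σ ^ 2 * V)) = -2 + 2 * Real.log δ := by
      rw [hu, mul_pow, Real.sq_sqrt (by positivity), hL, one_div, Real.log_inv]
      field_simp
      ring
    have h2 : Real.exp (2 * Real.log δ) = δ ^ 2 := by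
      rw [two_mul, Real.exp_add, Real.exp_log hδ0, sq]
    have h3 : Real.exp (-2) ≤ 1 / 6 := by
      rw [Real.exp_neg, one_div]
      apply inv_anti₀ (by norm_num)
      have : Real.exp 2 = Real.exp 1 * Real.exp 1 := by rw [← Real.exp_add]; norm_num
      nlinarith [Real.exp_one_gt_d9]
    rw [e, Real.exp_add, h2]
    calc Real.exp (-2) * δ ^ 2 ≤ 1 / 6 * δ := by
          gcongr
          nlinarith
      _ = δ / 6 := by ring
  have hw' : IsPredictable fun j y => -w j y :=
    ⟨fun j => (hw.measurable j).neg, fun j _ _ h => by rw [hw.congr j h]⟩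
  have hp := hz.measure_le_sum_le hσ hw n (u := u) (by positivity) hV
  have hm := hz.measure_le_sum_le hσ hw' n (u := u) (by positivity) hV
  simp only [neg_mul, neg_sq, Finset.sum_neg_distrib] at hm
  have hle := ENNReal.ofReal_le_ofReal hexp
  refine (measure_mono ?_).trans ((measure_union_le _ _).trans
    ((add_le_add (hp.trans hle) (hm.trans hle)).trans ?_))
  · rintro ω ⟨h1, h2⟩
    rcases lt_abs.1 h1 with h | h
    · exact Or.inl ⟨h.le, h2⟩
    · exact Or.inr ⟨h.le, h2⟩
  · rw [← ENNReal.ofReal_add (by positivity) (by positivity)]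
    apply le_of_eq
    ring_nf

end Noise

theorem exists_forall_div_mul_le {v e η : ℝ} (he : 0 < e) (hη : 0 < η) :
    ∃ k₀ : ℕ, ∀ k : ℕ, k₀ ≤ k → 0 < k → v / (e * k) ≤ η := by
  obtain ⟨k₀, hk₀⟩ := exists_nat_ge (v / (e * η))
  refine ⟨k₀, fun k hk hpos => ?_⟩
  have hk' : (0 : ℝ) < k := by exact_mod_cast hpos
  have h : v / (e * η) ≤ k := hk₀.trans (by exact_mod_cast hk)
  rw [div_le_iff₀ (by positivity)] at h ⊢
  linarith

/-- The least squares bound for a single trajectory of the affine system. -/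
theorem exists_const_ols_bound (a d : ℝ) (σ : ℝ≥0) (ha0 : 0 ≤ a) (ha1 : a < 1) (hσ : 0 < σ) :
    ∃ C : ℝ, 0 < C ∧ ∀ δ : ℝ, 0 < δ → δ < 1 → ∃ n₀ : ℕ,
      ∀ (Ω : Type*) [MeasurableSpace Ω] (μ : Measure Ω) [IsProbabilityMeasure μ]
        (z : ℕ → Ω → ℝ), IsGaussianNoise μ σ z → ∀ n : ℕ, n₀ ≤ n →
        (∀ᵐ ω ∂μ, IsUnit (gramMatrix n (affineTrajectory a d fun t => z t ω)).det) ∧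
        μ {ω | C * √(1 + Real.log (1 / δ)) * √(1 / (psi a d σ * n)) ≤
            ‖olsEstimator n (affineTrajectory a d fun t => z t ω) - !₂[a, d]‖}
          ≤ ENNReal.ofReal δ := by
  have hσ' : (0 : ℝ) < σ := hσ
  set K := energyBound a d σ with hKdef
  have hK : 0 < K := energyBound_pos ha1 hσ'
  have hψ : 0 < psi a d σ := psi_pos ha0 ha1 hσ'
  set B : ℝ := 64 * (√K + K) / σ with hB
  have hB0 : 0 < B := by positivity
  -- Any constant above `B * √ψ` works; it has to be strictly larger because the event in the
  -- theorem is closed.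
  refine ⟨2 * B * √(psi a d σ), by positivity, fun δ hδ0 hδ1 => ?_⟩
  have hlog : 0 < Real.log (1 / δ) := Real.log_pos (by rw [lt_div_iff₀ hδ0]; linarith)
  set L := 1 + Real.log (1 / δ) with hL
  obtain ⟨k₁, hk₁⟩ := exists_forall_div_mul_le
    (v := Var[fun t => t ^ 2; gaussianReal 0 (σ ^ 2)]) (e := ((σ : ℝ) ^ 2 / 4) ^ 2) (η := δ / 6)
    (by positivity) (by positivity)
  obtain ⟨k₂, hk₂⟩ := exists_forall_div_mul_le
    (v := Var[fun t => t; gaussianReal 0 (σ ^ 2)]) (e := ((σ : ℝ) / 2) ^ 2) (η := δ / 6)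
    (by positivity) (by positivity)
  refine ⟨max k₁ k₂ + 2, fun Ω _ μ _ z hz n hn => ⟨hz.ae_isUnit_det_gramMatrix hσ a d
    (le_trans (by omega) hn), ?_⟩⟩
  -- The covariates `x 0, …, x k` only involve the noise before time `k = n - 1`.
  obtain ⟨k, rfl⟩ : ∃ k, n = k + 1 := ⟨n - 1, by omega⟩
  have hk0 : 0 < k := by omega
  have hQ := (hz.measure_abs_sum_sub_ge_le (f := fun t => t ^ 2) (by fun_prop)
    (memLp_sq_gaussianReal σ) (ε := (σ : ℝ) ^ 2 / 4) (by positivity) hk0).trans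
    (ENNReal.ofReal_le_ofReal (hk₁ k (by omega) hk0))
  have hS := (hz.measure_abs_sum_sub_ge_le (f := fun t => t) (by fun_prop)
    (memLp_id_gaussianReal' 2 (by simp)) (ε := (σ : ℝ) / 2) (by positivity) hk0).trans
    (ENNReal.ofReal_le_ofReal (hk₂ k (by omega) hk0))
  simp only [integral_sq_gaussianReal] at hQ
  simp only [integral_id_gaussianReal, mul_zero, sub_zero] at hS
  have hn' : (0 : ℝ) < ((k + 1 : ℕ) : ℝ) := by positivity
  have hx : IsPredictable fun j y => affineTrajectory a d y j :=
    ⟨measurable_affineTrajectory a d, fun _ _ _ h => affineTrajectory_congr h⟩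
  have hone : IsPredictable fun _ _ => (1 : ℝ) := ⟨fun _ => measurable_const, fun _ _ _ _ => rfl⟩
  have hT := hz.measure_lt_abs_sum_le hσ hone (k + 1) hn' hδ0 hδ1
  have hXZ := hz.measure_lt_abs_sum_le hσ hx (k + 1) (mul_pos hK hn') hδ0 hδ1
  simp only [one_mul, one_pow, Finset.sum_const, Finset.card_range, nsmul_eq_mul, mul_one,
    le_refl, and_true] at hT
  refine (measure_mono ?_).trans ((measure_union_le _ _).trans ((add_le_add
    ((measure_union_le _ _).trans (add_le_add hQ hS))
    ((measure_union_le _ _).trans (add_le_add hT hXZ))).trans ?_))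
  · intro ω hω
    by_contra hgood
    simp only [Set.mem_union, Set.mem_ofPred_eq, not_or, not_le, not_lt, not_and] at hgood
    obtain ⟨⟨g1, g2⟩, g3, g4⟩ := hgood
    rw [abs_lt] at g1
    have hxx := sum_sq_affineTrajectory_le_energyBound (d := d) (σ := σ) ha0 ha1
      (z := fun t => z t ω) (k := k) (by linarith)
    have hdet := le_det_gramMatrix (d := d) (σ := σ) ha0 ha1 (z := fun t => z t ω) hk0
      (by linarith) g2.le
    have hxx' : ∑ j ∈ Finset.range (k + 1), affineTrajectory a d (fun t => z t ω) j ^ 2 ≤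
        K * ((k + 1 : ℕ) : ℝ) := by push_cast; exact hxx
    have hfin := norm_olsEstimator_sub_le (a := a) (d := d) (L := L) hσ' hK (by positivity)
      (z := fun t => z t ω) (n := k + 1) (by omega) hxx' (by push_cast; exact hdet) g3
      (not_lt.1 fun h => (g4 h).not_ge hxx')
    have hpos : 0 < B * (√L * √(1 / ((k + 1 : ℕ) : ℝ))) := by positivity
    have e : 2 * B * √(psi a d σ) * √L * √(1 / (psi a d σ * ((k + 1 : ℕ) : ℝ))) =
        2 * (B * (√L * √(1 / ((k + 1 : ℕ) : ℝ)))) := by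
      have : √(psi a d σ) * √(1 / (psi a d σ * ((k + 1 : ℕ) : ℝ))) =
          √(1 / ((k + 1 : ℕ) : ℝ)) := by
        rw [← Real.sqrt_mul hψ.le]
        congr 1
        field_simp
      rw [← this]
      ring
    rw [Set.mem_ofPred_eq, e] at hω
    linarith
  · rw [← ENNReal.ofReal_add (by positivity) (by positivity),
      ← ENNReal.ofReal_add (by positivity) (by positivity),
      ← ENNReal.ofReal_add (by positivity) (by positivity)]
    apply le_of_eq
    ring_nf

/-! ### Aggregated noise -/

theorem hasLaw_sum_mul_gaussianReal {Ω : Type*} [MeasurableSpace Ω] {μ : Measure Ω}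
    {ι : Type*} {X : ι → Ω → ℝ} {v : ℝ≥0} (hind : iIndepFun X μ)
    (hX : ∀ i, HasLaw (X i) (gaussianReal 0 v) μ) (c : ι → ℝ) (s : Finset ι) :
    HasLaw (∑ i ∈ s, fun ω => c i * X i ω)
      (gaussianReal 0 (∑ i ∈ s, (.mk (c i ^ 2) (sq_nonneg _) * v))) μ := by
  have := hind.isProbabilityMeasure
  have hlaw : ∀ i, HasLaw (fun ω => c i * X i ω)
      (gaussianReal 0 (.mk (c i ^ 2) (sq_nonneg _) * v)) μ := fun i => by
    simpa using gaussianReal_const_mul (hX i) (c i)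
  classical
  induction s using Finset.induction_on with
  | empty =>
    simp only [Finset.sum_empty, gaussianReal_zero_var]
    exact hasLaw_dirac_of_ae_eq (by rfl)
  | insert i s hi ih =>
    have h := ((hind.comp (fun i t => c i * t) fun i => by fun_prop).indepFun_finsetSum_of_notMem₀
      (fun i => (hlaw i).aemeasurable) hi).symm
    refine ⟨Finset.aemeasurable_sum _ fun j _ => (hlaw j).aemeasurable, ?_⟩
    rw [Finset.sum_insert hi, Finset.sum_insert hi]
    have := gaussianReal_add_gaussianReal_of_indepFun h (hlaw i).map_eq ih.map_eq
    rwa [add_zero] at this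

/-- Families of independent variables, grouped into blocks, are independent. -/
theorem ProbabilityTheory.iIndepFun.curry {Ω : Type*} [MeasurableSpace Ω] {μ : Measure Ω}
    {ι κ E : Type*} [Countable ι] [Countable κ] [MeasurableSpace E] {X : ι × κ → Ω → E}
    (h : iIndepFun X μ) (hX : ∀ p, AEMeasurable (X p) μ) :
    iIndepFun (fun i ω k => X (i, k) ω) μ := by
  have := h.isProbabilityMeasure
  have _ p := Measure.isProbabilityMeasure_map (hX p)
  have hrow : ∀ i, AEMeasurable (fun ω k => X (i, k) ω) μ := fun i =>
    aemeasurable_pi_iff.2 fun k => hX (i, k)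
  rw [iIndepFun_iff_map_fun_eq_infinitePi_map₀' hrow]
  have e : ∀ i, μ.map (fun ω k => X (i, k) ω) =
      Measure.infinitePi fun k => μ.map (X (i, k)) := fun i =>
    (h.precomp (Prod.mk_right_injective i)).map_fun_eq_infinitePi_map₀' fun k => hX (i, k)
  simp only [e]
  rw [← Measure.infinitePi_map_curry (fun i k => μ.map (X (i, k))),
    ← h.map_fun_eq_infinitePi_map₀' hX,
    AEMeasurable.map_map_of_aemeasurable (by fun_prop) (aemeasurable_pi_iff.2 hX)]
  rfl

/-- Weighted sums over disjoint blocks of Gaussian noise are Gaussian noise. -/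
theorem IsGaussianNoise.sum_blocks {Ω : Type*} [MeasurableSpace Ω] {μ : Measure Ω} {σ τ : ℝ≥0}
    {z : ℕ → Ω → ℝ} (hz : IsGaussianNoise μ σ z) {κ : Type*} [Fintype κ] {e : ℕ × κ → ℕ}
    (he : e.Injective) (c : κ → ℝ) (hτ : (τ : ℝ) ^ 2 = (∑ i, c i ^ 2) * σ ^ 2) :
    IsGaussianNoise μ τ fun j ω => ∑ i, c i * z (e (j, i)) ω := by
  have hX : iIndepFun (fun p => z (e p)) μ := hz.1.precomp he
  refine ⟨?_, fun j => ?_⟩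
  · exact (hX.curry fun p => hz.aemeasurable _).comp (fun _ y => ∑ i, c i * y i)
      fun _ => by fun_prop
  · have h := hasLaw_sum_mul_gaussianReal (hX.precomp (Prod.mk_right_injective j))
      (fun i => hz.2 _) c Finset.univ
    have hv : ∑ i, (.mk (c i ^ 2) (sq_nonneg _) * σ ^ 2 : ℝ≥0) = τ ^ 2 := by
      rw [← NNReal.coe_inj]
      push_cast
      rw [hτ, Finset.sum_mul]
    rw [hv] at h
    convert h using 1
    ext ω
    simp

/-! ### The periodically pulled arm -/

theorem satiation_of_le {γ : ℝ} {t₀ m : ℕ} (z : ℕ → ℝ) {t : ℕ} (ht : t ≤ t₀) :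
    satiation γ (periodicPulls t₀ m) z t = 0 := by
  cases t with
  | zero => rfl
  | succ t =>
    rw [satiation, if_neg]
    rintro ⟨i, hi, j, rfl⟩
    have := Nat.zero_le (j * m)
    omega

theorem satiation_succ_of_mem {γ : ℝ} {t₀ m : ℕ} (z : ℕ → ℝ) {t : ℕ}
    (ht : t ∈ periodicPulls t₀ m) :
    satiation γ (periodicPulls t₀ m) z (t + 1) =
      γ * (satiation γ (periodicPulls t₀ m) z t + 1) + z t := by
  rw [satiation, if_pos ⟨t, le_rfl, ht⟩, if_pos ht]

theorem satiation_succ_of_notMem {γ : ℝ} {t₀ m : ℕ} (z : ℕ → ℝ) {t : ℕ} (h0 : t₀ ≤ t)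
    (ht : t ∉ periodicPulls t₀ m) :
    satiation γ (periodicPulls t₀ m) z (t + 1) =
      γ * satiation γ (periodicPulls t₀ m) z t + z t := by
  rw [satiation, if_pos ⟨t₀, h0, 0, by simp⟩, if_neg ht, add_zero]

theorem add_notMem_periodicPulls {t₀ m j r : ℕ} (hr : r + 1 < m) :
    t₀ + j * m + (r + 1) ∉ periodicPulls t₀ m := by
  rintro ⟨i, hi⟩
  rcases Nat.lt_or_ge j i with h | h
  · have := Nat.mul_le_mul_right m (Nat.succ_le_of_lt h)
    rw [Nat.succ_mul] at this
    omega
  · have := Nat.mul_le_mul_right m h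
    omega

/-- The satiation level `r + 1` rounds after a pull, up to and including the next pull. -/
theorem satiation_after_pull (γ : ℝ) (t₀ : ℕ) {m : ℕ} (z : ℕ → ℝ) (j : ℕ) {r : ℕ}
    (hr : r + 1 ≤ m) :
    satiation γ (periodicPulls t₀ m) z (t₀ + j * m + (r + 1)) =
      γ ^ (r + 1) * (satiation γ (periodicPulls t₀ m) z (t₀ + j * m) + 1) +
        ∑ i ∈ Finset.range (r + 1), γ ^ (r - i) * z (t₀ + j * m + i) := by
  induction r with
  | zero =>
    rw [zero_add, satiation_succ_of_mem z ⟨j, rfl⟩]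
    simp
  | succ r ih =>
    rw [← add_assoc _ (r + 1) 1, satiation_succ_of_notMem z (by omega)
      (add_notMem_periodicPulls (by omega)), ih (by omega), Finset.sum_range_succ _ (r + 1),
      mul_add, Finset.mul_sum]
    have : ∑ i ∈ Finset.range (r + 1), γ * (γ ^ (r - i) * z (t₀ + j * m + i)) =
        ∑ i ∈ Finset.range (r + 1), γ ^ (r + 1 - i) * z (t₀ + j * m + i) :=
      Finset.sum_congr rfl fun i hi => by
        rw [Nat.sub_add_comm (Nat.lt_succ_iff.1 (Finset.mem_range.1 hi)), pow_succ]
        ring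
    rw [this]
    simp
    ring

/-- At the pull times, the observed influence follows the affine system whose noise is the
discounted noise accumulated since the previous pull. -/
theorem observedInfluence_eq_affineTrajectory (b lam γ : ℝ) (t₀ : ℕ) {m : ℕ} (hm : 1 ≤ m)
    (z : ℕ → ℝ) :
    observedInfluence b lam γ t₀ m z = affineTrajectory (γ ^ m) (lam * γ ^ m)
      fun j => ∑ i : Fin m, lam * γ ^ (m - 1 - (i : ℕ)) * z (t₀ + j * m + i) := by
  have hobs : ∀ j, observedInfluence b lam γ t₀ m z j =
      lam * satiation γ (periodicPulls t₀ m) z (t₀ + j * m) := fun j => by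
    simp [observedInfluence, reward, satiation_of_le]
  ext j
  induction j with
  | zero => simp [hobs, satiation_of_le, affineTrajectory]
  | succ j ih =>
    obtain ⟨r, rfl⟩ : ∃ r, m = r + 1 := ⟨m - 1, by omega⟩
    rw [affineTrajectory, ← ih, hobs, hobs, show t₀ + (j + 1) * (r + 1) =
      t₀ + j * (r + 1) + (r + 1) by ring, satiation_after_pull γ t₀ z j le_rfl,
      Finset.sum_range, mul_add, Finset.mul_sum]
    simp only [Nat.add_sub_cancel, mul_assoc]
    ring

theorem sum_sq_discount {γ lam : ℝ} (h0 : 0 ≤ γ) (h1 : γ < 1) (m : ℕ) :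
    ∑ i : Fin m, (lam * γ ^ (m - 1 - (i : ℕ))) ^ 2 =
      lam ^ 2 * (1 - γ ^ (2 * m)) / (1 - γ ^ 2) := by
  have hne : γ ^ 2 ≠ 1 := by nlinarith
  have hne' : 1 - γ ^ 2 ≠ 0 := sub_ne_zero.2 hne.symm
  have := Finset.sum_range_reflect (fun i => (lam * γ ^ i) ^ 2) m
  rw [← Finset.sum_range fun i => (lam * γ ^ (m - 1 - i)) ^ 2, this]
  have e : ∀ i, (lam * γ ^ i) ^ 2 = lam ^ 2 * (γ ^ 2) ^ i := fun i => by ring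
  simp only [e]
  rw [← Finset.mul_sum, geom_sum_eq hne, pow_mul, ← neg_sub (1 : ℝ), ← neg_sub (1 : ℝ),
    neg_div_neg_eq, mul_div_assoc]

theorem influenceNoiseSd_pos {γ lam σz : ℝ} {m : ℕ} (h0 : 0 ≤ γ) (h1 : γ < 1) (hl : 0 < lam)
    (hσ : 0 < σz) (hm : 1 ≤ m) : 0 < influenceNoiseSd lam γ σz m := by
  have h2 : 0 < 1 - γ ^ 2 := by nlinarith
  have h3 : 0 < 1 - γ ^ (2 * m) := sub_pos.2 (pow_lt_one₀ h0 h1 (by omega))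
  exact Real.sqrt_pos.2 (by positivity)

/-- The noise driving the observed influence is Gaussian noise, as consecutive pulls collect it over
disjoint time windows. -/
theorem IsGaussianNoise.influenceNoise {Ω : Type*} [MeasurableSpace Ω] {μ : Measure Ω}
    {σz τ : ℝ≥0} {z : ℕ → Ω → ℝ} (hz : IsGaussianNoise μ σz z) {γ lam : ℝ} {m : ℕ} (h0 : 0 ≤ γ)
    (h1 : γ < 1) (hτ : (τ : ℝ) = influenceNoiseSd lam γ σz m) (t₀ : ℕ) :
    IsGaussianNoise μ τ
      fun j ω => ∑ i : Fin m, lam * γ ^ (m - 1 - (i : ℕ)) * z (t₀ + j * m + i) ω := by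
  have hinj : (fun p : ℕ × Fin m => t₀ + p.1 * m + (p.2 : ℕ)).Injective := by
    rintro ⟨j, i⟩ ⟨j', i'⟩ h
    have hm : 0 < m := i.pos
    have h' : i + m * j = i' + m * j' := by
      simp only at h
      rw [mul_comm m, mul_comm m]
      omega
    have hmod := congrArg (· % m) h'
    have hdiv := congrArg (· / m) h'
    simp [Nat.add_mul_mod_self_left, Nat.mod_eq_of_lt] at hmod
    simp [Nat.add_mul_div_left _ _ hm, Nat.div_eq_of_lt] at hdiv
    exact Prod.ext hdiv (Fin.ext hmod)
  refine hz.sum_blocks hinj (fun i : Fin m => lam * γ ^ (m - 1 - (i : ℕ))) ?_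
  have h2 : 0 < 1 - γ ^ 2 := by nlinarith
  have h3 : 0 ≤ 1 - γ ^ (2 * m) := sub_nonneg.2 (pow_le_one₀ h0 h1.le)
  rw [sum_sq_discount h0 h1, hτ, influenceNoiseSd, Real.sq_sqrt (by positivity)]
  ring

theorem theorem3 :
    (∀ (a d : ℝ) (σ : ℝ≥0), 0 ≤ a → a < 1 → 0 < σ →
      ∃ C : ℝ, 0 < C ∧ ∀ δ : ℝ, 0 < δ → δ < 1 → ∃ n₀ : ℕ,
        ∀ (Ω : Type*) [MeasurableSpace Ω] (μ : Measure Ω) [IsProbabilityMeasure μ]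
          (z : ℕ → Ω → ℝ), IsGaussianNoise μ σ z → ∀ n : ℕ, n₀ ≤ n →
          (∀ᵐ ω ∂μ, IsUnit (gramMatrix n (affineTrajectory a d fun t => z t ω)).det) ∧
          μ {ω | C * √(1 + Real.log (1 / δ)) * √(1 / (psi a d σ * n)) ≤
              ‖olsEstimator n (affineTrajectory a d fun t => z t ω) - !₂[a, d]‖}
            ≤ ENNReal.ofReal δ) ∧
    (∀ (γ lam : ℝ) (σz : ℝ≥0) (m : ℕ), 0 ≤ γ → γ < 1 → 0 < lam → 0 < σz → 1 ≤ m →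
      ∃ C : ℝ, 0 < C ∧ ∀ δ : ℝ, 0 < δ → δ < 1 → ∃ n₀ : ℕ,
        ∀ (Ω : Type*) [MeasurableSpace Ω] (μ : Measure Ω) [IsProbabilityMeasure μ]
          (z : ℕ → Ω → ℝ), IsGaussianNoise μ σz z →
          ∀ (b : ℝ) (t₀ : ℕ) (n : ℕ), n₀ ≤ n →
          (∀ᵐ ω ∂μ, IsUnit
            (gramMatrix n (observedInfluence b lam γ t₀ m fun t => z t ω)).det) ∧
          μ {ω | C * √(1 + Real.log (1 / δ)) *
                √(1 / (psi (γ ^ m) (lam * γ ^ m) (influenceNoiseSd lam γ σz m) * n)) ≤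
              ‖olsEstimator n (observedInfluence b lam γ t₀ m fun t => z t ω) -
                !₂[γ ^ m, lam * γ ^ m]‖}
            ≤ ENNReal.ofReal δ) := by
  refine ⟨exists_const_ols_bound, fun γ lam σz m hγ0 hγ1 hlam hσz hm => ?_⟩
  have hτ := influenceNoiseSd_pos hγ0 hγ1 hlam (NNReal.coe_pos.2 hσz) hm
  let τ : ℝ≥0 := ⟨influenceNoiseSd lam γ σz m, hτ.le⟩
  obtain ⟨C, hC, h⟩ := exists_const_ols_bound (γ ^ m) (lam * γ ^ m) τ (pow_nonneg hγ0 m)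
    (pow_lt_one₀ hγ0 hγ1 (by omega)) hτ
  refine ⟨C, hC, fun δ hδ0 hδ1 => ?_⟩
  obtain ⟨n₀, hn₀⟩ := h δ hδ0 hδ1
  refine ⟨n₀, fun Ω _ μ _ z hz b t₀ n hn => ?_⟩
  simp only [observedInfluence_eq_affineTrajectory b lam γ t₀ hm]
  exact hn₀ Ω μ _ (hz.influenceNoise hγ0 hγ1 rfl t₀) n hn
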